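/- There exist absolute constants $C,c>0$ such that the following holds. Let $n,m\in\mathbb N$, let $0<s\le n$ be real, let $\delta>0$, and put $K_{n,s}=\{x\in\mathbb R^n:\ \|x\|_2\le 1,\ \|x\|_1\le\sqrt s\}$. Let $a_1,\dots,a_m$ be independent standard Gaussian random vectors in $\mathbb R^n$, and fix $x\in K_{n,s}$ with $\|x\|_2=1$. Let $y_1,\dots,y_m$ be $\{-1,1\}$-valued random variables which are conditionally independent given $\{a_1,\dots,a_m\}$ and satisfy $$\mathbb E\big[y_i\mid a_1,\dots,a_m\big]=\theta(\langle a_i,x\rangle)\quad\text{almost surely},\qquad i=1,\dots,m,$$ for some measurable function $\theta:\mathbb R\to\mathbb R$ (which may be unknown) with $\lambda:=\mathbb E\,\theta(g)g>0$, where $g$ is a standard normal random variable. Suppose that $$m\ \ge\ C\,\delta^{-2}\,s\log(2n/s).$$ Then with probability at least $1-8\exp(-c\,\delta^2 m)$ the convex program $$\max\ \sum_{i=1}^m y_i\langle a_i,x'\rangle\quad\text{subject to}\quad \|x'\|_1\le\sqrt s\ \text{ and }\ \|x'\|_2\le 1$$ has a solution, and every solution $\hat x$ of it satisfies $\|\hat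 x-x\|_2^2\le\delta/\lambda$. -/

import Mathlib

open MeasureTheory ProbabilityTheory
open scoped RealInnerProductSpace

noncomputable section

/-- The set `K_{n,s} = B₂ⁿ ∩ √s B₁ⁿ` of compressible signals. -/
def compressibleSet (n : ℕ) (s : ℝ) : Set (EuclideanSpace ℝ (Fin n)) :=
  {x | ‖x‖ ≤ 1 ∧ ∑ j, |x j| ≤ √s}

/-- The correlation coefficient `λ = 𝔼 θ(g) g`, where `g` is a standard normal variable. -/
def linkCorrelation (θ : ℝ → ℝ) : ℝ :=
  ∫ z, θ z * z ∂(gaussianReal 0 1)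

/-- The σ-algebra generated by all the random vectors `a i`. -/
abbrev measurementSigma {Ω : Type*} {n m : ℕ} (a : Fin m → Ω → EuclideanSpace ℝ (Fin n)) :
    MeasurableSpace Ω :=
  MeasurableSpace.comap (fun ω i => a i ω) inferInstance

/-- The real random variables `y i` are independent conditionally on the σ-algebra `𝒢`
(on an arbitrary probability space, which need not be standard Borel). -/
def CondIndependent {Ω ι : Type*} [MeasurableSpace Ω] (μ : Measure Ω) (𝒢 : MeasurableSpace Ω)
    (y : ι → Ω → ℝ) : Prop :=
  ∀ (S : Finset ι) (B : ι → Set ℝ), (∀ i ∈ S, MeasurableSet (B i)) →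
    μ⟦⋂ i ∈ S, y i ⁻¹' B i | 𝒢⟧ =ᵐ[μ] ∏ i ∈ S, μ⟦y i ⁻¹' B i | 𝒢⟧

/-- The noisy one-bit (generalized linear) measurement model with Gaussian measurement vectors `a i`,
responses `y i`, signal `x` and inverse link function `θ`. -/
structure IsOneBitModel {Ω : Type*} [MeasurableSpace Ω] (μ : Measure Ω) {n m : ℕ}
    (θ : ℝ → ℝ) (x : EuclideanSpace ℝ (Fin n))
    (a : Fin m → Ω → EuclideanSpace ℝ (Fin n)) (y : Fin m → Ω → ℝ) : Prop where
  /-- The `a i` are random vectors. -/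
  measurable_a : ∀ i, Measurable (a i)
  /-- Each `a i` is a standard Gaussian vector in `ℝⁿ`. -/
  law_a : ∀ i, HasLaw (a i) (stdGaussian (EuclideanSpace ℝ (Fin n))) μ
  /-- The `a i` are independent. -/
  indep_a : iIndepFun a μ
  /-- The `y i` are random variables. -/
  measurable_y : ∀ i, Measurable (y i)
  /-- The `y i` take values in `{-1, 1}` almost surely. -/
  sign_y : ∀ i, ∀ᵐ ω ∂μ, y i ω = -1 ∨ y i ω = 1
  /-- Given `{a i}`, the `y i` are independent. -/
  condIndep_y : CondIndependent μ (measurementSigma a) y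
  /-- Given `{a i}`, the mean of `y i` is `θ(⟨a i, x⟩)`. -/
  condMean_y : ∀ i, μ[y i | measurementSigma a] =ᵐ[μ] fun ω => θ ⟪a i ω, x⟫

/-- `xhat` solves the convex program: maximize `∑ᵢ bᵢ ⟨vᵢ, x'⟩` subject to
`‖x'‖₁ ≤ √s` and `‖x'‖₂ ≤ 1`. -/
def IsProgramSolution {n m : ℕ} (s : ℝ) (v : Fin m → EuclideanSpace ℝ (Fin n)) (b : Fin m → ℝ)
    (xhat : EuclideanSpace ℝ (Fin n)) : Prop :=
  xhat ∈ compressibleSet n s ∧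
    IsMaxOn (fun x' => ∑ i, b i * ⟪v i, x'⟫) (compressibleSet n s) xhat

end

/-! Multiply the part of `a i` orthogonal to `x` by `y i`. The conditional mean of `y i` depends on
`⟪a i, x⟫` only, which the reflection in the axis `ℝ ∙ x` fixes, so the result is again standard
Gaussian (`hasLaw_flipOrthogonal`). The pairs `(a i, y i)` are independent
(`CondIndependent.iIndepFun_prodMk`), hence the sum `w` of the flipped vectors is `√m` times a
standard Gaussian vector.

With `S = ∑ y i ⟪a i, x⟫`, the objective at `z` is `⟪w, z⟫ + (S - ⟪w, x⟫) ⟪x, z⟫`. Comparing a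
maximizer with `x` therefore bounds `S (1 - ⟪x, xhat⟫)` by the size of `w` on the feasible set, and
`2 (1 - ⟪x, xhat⟫)` dominates `‖xhat - x‖²` (`mul_norm_sub_sq_le_of_isProgramSolution`).

Two estimates remain. A Chernoff bound gives `S ≥ m (λ - δ/8)`. Soft thresholding at `T = 2 √(log
(2n/s))` controls `w` uniformly on the feasible set: the excess over `T` is paired with the ℓ²
constraint and `T` itself with the ℓ¹ constraint, so no chaining or net is needed. -/

/-! ### Independence of pairs from conditional independence -/

/-- Conditioning on `𝒢` turns both sides into integrals of functions of the `a i`, to which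
independence of the `a i` applies. Rectangles suffice because they form a generating π-system. -/
theorem CondIndependent.measure_iInter_prodMk {Ω E : Type*} {𝒢 : MeasurableSpace Ω}
    [mΩ : MeasurableSpace Ω]
    [MeasurableSpace E] {μ : Measure Ω} [IsProbabilityMeasure μ] {ι : Type*} [Fintype ι]
    (h𝒢 : 𝒢 ≤ mΩ)
    {a : ι → Ω → E} {y : ι → Ω → ℝ} (ha : ∀ i, Measurable[𝒢] (a i)) (hind : iIndepFun a μ)
    (hy : ∀ i, Measurable (y i)) (hcond : CondIndependent μ 𝒢 y)
    (hker : ∀ i (B : Set ℝ), MeasurableSet B → ∃ φ : E → ℝ, Measurable φ ∧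
      μ⟦y i ⁻¹' B | 𝒢⟧ =ᵐ[μ] fun ω => φ (a i ω))
    (A : ι → Set E) (B : ι → Set ℝ) (hA : ∀ i, MeasurableSet (A i))
    (hB : ∀ i, MeasurableSet (B i)) :
    μ.real (⋂ i, (a i ⁻¹' A i ∩ y i ⁻¹' B i)) = ∏ i, μ.real (a i ⁻¹' A i ∩ y i ⁻¹' B i) := by
  choose φ hφm hφ using fun i => hker i (B i) (hB i)
  have hm : ∀ i, Measurable (a i) := fun i => (ha i).mono h𝒢 le_rfl
  have key : ∀ (U V : Set Ω), MeasurableSet[𝒢] U → MeasurableSet V →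
      μ.real (U ∩ V) = ∫ ω in U, (μ⟦V | 𝒢⟧) ω ∂μ := by
    intro U V hU hV
    rw [setIntegral_condExp h𝒢 ((integrable_const _).indicator hV) hU,
      setIntegral_indicator hV]
    simp
  have hone : ∀ i, μ.real (a i ⁻¹' A i ∩ y i ⁻¹' B i)
      = ∫ ω, (A i).indicator (φ i) (a i ω) ∂μ := by
    intro i
    rw [key _ _ (ha i (hA i)) (hy i (hB i)), ← integral_indicator (hm i (hA i))]
    refine integral_congr_ae ?_
    filter_upwards [hφ i] with ω hω
    by_cases h : a i ω ∈ A i <;> simp [Set.indicator, h, hω]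
  have hall : μ.real (⋂ i, (a i ⁻¹' A i ∩ y i ⁻¹' B i))
      = ∫ ω, ∏ i, (A i).indicator (φ i) (a i ω) ∂μ := by
    have hc := hcond Finset.univ B (fun i _ => hB i)
    simp only [Finset.mem_univ, Set.iInter_true] at hc
    have hU : MeasurableSet[𝒢] (⋂ i, a i ⁻¹' A i) := by
      exact MeasurableSet.iInter fun i => ha i (hA i)
    rw [Set.iInter_inter_distrib, key _ _ hU (MeasurableSet.iInter fun i => hy i (hB i)),
      ← integral_indicator (h𝒢 _ hU)]
    refine integral_congr_ae ?_
    filter_upwards [hc, ae_all_iff.2 hφ] with ω h1 h2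
    by_cases h : ∀ i, a i ω ∈ A i
    · simp [Set.indicator, h, h1, h2, Finset.prod_apply]
    · obtain ⟨i, hi⟩ := not_forall.1 h
      rw [Finset.prod_eq_zero (Finset.mem_univ i) (by simp [hi])]
      simp [Set.indicator, h]
  rw [hall]
  simp_rw [hone]
  exact hind.integral_fun_prod_comp (fun i => (hm i).aemeasurable)
    (fun i => ((hφm i).indicator (hA i)).aestronglyMeasurable)

/-- If the `a i` are independent, the `y i` are conditionally independent given the `a i`, and the
conditional law of `y i` depends on `a i` only, then the pairs `(a i, y i)` are independent. -/
theorem CondIndependent.iIndepFun_prodMk {Ω E : Type*} {𝒢 : MeasurableSpace Ω}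
    [mΩ : MeasurableSpace Ω]
    [MeasurableSpace E] {μ : Measure Ω} [IsProbabilityMeasure μ] {ι : Type*} [Fintype ι]
    (h𝒢 : 𝒢 ≤ mΩ)
    {a : ι → Ω → E} {y : ι → Ω → ℝ} (ha : ∀ i, Measurable[𝒢] (a i)) (hind : iIndepFun a μ)
    (hy : ∀ i, Measurable (y i)) (hcond : CondIndependent μ 𝒢 y)
    (hker : ∀ i (B : Set ℝ), MeasurableSet B → ∃ φ : E → ℝ, Measurable φ ∧
      μ⟦y i ⁻¹' B | 𝒢⟧ =ᵐ[μ] fun ω => φ (a i ω)) :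
    iIndepFun (fun i ω => (a i ω, y i ω)) μ := by
  classical
  have hm : ∀ i, Measurable (fun ω => (a i ω, y i ω)) :=
    fun i => ((ha i).mono h𝒢 le_rfl).prodMk (hy i)
  let R : Set (Set (E × ℝ)) := Set.image2 (· ×ˢ ·) {s | MeasurableSet s} {t | MeasurableSet t}
  refine iIndepSets.iIndep (fun i => (hm i).comap_le)
    (fun i => {s | ∃ t ∈ R, (fun ω => (a i ω, y i ω)) ⁻¹' t = s})
    (fun i => isPiSystem_prod.comap _) (fun i => ?_) ?_
  · rw [← generateFrom_prod, MeasurableSpace.comap_generateFrom]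
    rfl
  · rw [iIndepSets_iff]
    intro S f hf
    -- Indices outside `S` are padded with the full space, so that the product formula over all
    -- indices applies.
    have hex : ∀ i, ∃ (A : Set E) (B : Set ℝ), MeasurableSet A ∧ MeasurableSet B ∧
        (if i ∈ S then f i else Set.univ) = a i ⁻¹' A ∩ y i ⁻¹' B := by
      intro i
      by_cases hi : i ∈ S
      · obtain ⟨t, ⟨A, hA, B, hB, rfl⟩, ht⟩ := hf i hi
        refine ⟨A, B, hA, hB, ?_⟩
        rw [if_pos hi, ← ht]
        rfl
      · exact ⟨Set.univ, Set.univ, .univ, .univ, by simp [hi]⟩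
    choose A B hA hB hAB using hex
    have h := hcond.measure_iInter_prodMk h𝒢 ha hind hy hker A B hA hB
    simp_rw [← hAB] at h
    have h1 : (⋂ i, if i ∈ S then f i else Set.univ) = ⋂ i ∈ S, f i := by
      ext ω
      simp only [Set.mem_iInter]
      refine forall_congr' fun i => ?_
      by_cases hi : i ∈ S <;> simp [hi]
    have h2 : ∏ i, μ.real (if i ∈ S then f i else Set.univ) = ∏ i ∈ S, μ.real (f i) := by
      rw [← Finset.prod_subset (Finset.subset_univ S)]
      · exact Finset.prod_congr rfl fun i hi => by simp [hi]
      · intro i _ hi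
        simp [hi]
    rw [h1, h2] at h
    rw [← ENNReal.toReal_eq_toReal_iff' (measure_ne_top _ _)
      (ENNReal.prod_ne_top fun i _ => measure_ne_top _ _), ENNReal.toReal_prod]
    exact h

/-! ### Conditional moments and laws in the one-bit model -/

section Model

variable {Ω : Type*} [MeasurableSpace Ω] {μ : Measure Ω} [IsProbabilityMeasure μ] {n m : ℕ}
  {θ : ℝ → ℝ} {x : EuclideanSpace ℝ (Fin n)} {a : Fin m → Ω → EuclideanSpace ℝ (Fin n)}
  {y : Fin m → Ω → ℝ}

namespace IsOneBitModel

omit [IsProbabilityMeasure μ] in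
theorem measurementSigma_le (h : IsOneBitModel μ θ x a y) :
    measurementSigma a ≤ ‹MeasurableSpace Ω› :=
  (measurable_pi_lambda _ h.measurable_a).comap_le

omit [MeasurableSpace Ω] in
theorem measurable_measurementSigma (a : Fin m → Ω → EuclideanSpace ℝ (Fin n)) (i : Fin m) :
    Measurable[measurementSigma a] (a i) :=
  (measurable_pi_apply i).comp (comap_measurable fun ω i => a i ω)

omit [IsProbabilityMeasure μ] in
theorem ae_abs_y_le (h : IsOneBitModel μ θ x a y) (i : Fin m) : ∀ᵐ ω ∂μ, ‖y i ω‖ ≤ 1 := by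
  filter_upwards [h.sign_y i] with ω hω
  rcases hω with hω | hω <;> simp [hω]

theorem integrable_y (h : IsOneBitModel μ θ x a y) (i : Fin m) : Integrable (y i) μ :=
  Integrable.of_bound (h.measurable_y i).aestronglyMeasurable 1 (h.ae_abs_y_le i)

omit [IsProbabilityMeasure μ] in
theorem integrable_y_mul (h : IsOneBitModel μ θ x a y) (i : Fin m)
    {f : Ω → ℝ} (hf : Integrable f μ) : Integrable (fun ω => y i ω * f ω) μ :=
  hf.bdd_mul (h.measurable_y i).aestronglyMeasurable (h.ae_abs_y_le i)

theorem integral_y_mul (h : IsOneBitModel μ θ x a y) (i : Fin m)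
    {ψ : EuclideanSpace ℝ (Fin n) → ℝ} (hψ : Measurable ψ)
    (hint : Integrable (fun ω => ψ (a i ω)) μ) :
    ∫ ω, y i ω * ψ (a i ω) ∂μ = ∫ ω, θ ⟪a i ω, x⟫ * ψ (a i ω) ∂μ := by
  have hsm : StronglyMeasurable[measurementSigma a] (fun ω => ψ (a i ω)) :=
    (hψ.comp (measurable_measurementSigma a i)).stronglyMeasurable
  rw [← integral_condExp h.measurementSigma_le]
  refine integral_congr_ae ?_
  have h1 := condExp_mul_of_stronglyMeasurable_right (f := y i) hsm
    (h.integrable_y_mul i hint) (h.integrable_y i)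
  filter_upwards [h1, h.condMean_y i] with ω h1 h2
  refine h1.trans ?_
  simp [h2]

/-- A `±1`-valued variable has its law determined by its mean: the indicator of `B` at `y i` is an
affine function of `y i`. -/
theorem condProb_y (h : IsOneBitModel μ θ x a y) (hθ : Measurable θ) (i : Fin m) (B : Set ℝ)
    (_hB : MeasurableSet B) :
    ∃ φ : EuclideanSpace ℝ (Fin n) → ℝ, Measurable φ ∧
      μ⟦y i ⁻¹' B | measurementSigma a⟧ =ᵐ[μ] fun ω => φ (a i ω) := by
  set p : ℝ := B.indicator (fun _ => 1) 1
  set q : ℝ := B.indicator (fun _ => 1) (-1)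
  refine ⟨fun v => (p + q) / 2 + (p - q) / 2 * θ ⟪v, x⟫, by fun_prop, ?_⟩
  have h1 : (y i ⁻¹' B).indicator (fun _ => (1 : ℝ)) =ᵐ[μ]
      (fun _ => (p + q) / 2) + (((p - q) / 2) • y i) := by
    filter_upwards [h.sign_y i] with ω hω
    have : (y i ⁻¹' B).indicator (fun _ => (1 : ℝ)) ω = B.indicator (fun _ => 1) (y i ω) := rfl
    rw [this]
    rcases hω with hω | hω
    · rw [hω]; simp [hω]; change q = _; ring
    · rw [hω]; simp [hω]; change p = _; ring
  have h2 := condExp_add (μ := μ) (integrable_const ((p + q) / 2))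
    ((h.integrable_y i).smul ((p - q) / 2)) (measurementSigma a)
  have h3 := condExp_smul (μ := μ) ((p - q) / 2) (y i) (measurementSigma a)
  filter_upwards [condExp_congr_ae (m := measurementSigma a) h1, h2, h3, h.condMean_y i]
    with ω h1 h2 h3 h4
  rw [h1, h2, Pi.add_apply, h3, condExp_const h.measurementSigma_le]
  simp [h4]

theorem iIndepFun_prodMk (h : IsOneBitModel μ θ x a y) (hθ : Measurable θ) :
    iIndepFun (fun i ω => (a i ω, y i ω)) μ :=
  h.condIndep_y.iIndepFun_prodMk h.measurementSigma_le (measurable_measurementSigma a)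
    h.indep_a h.measurable_y (h.condProb_y hθ)

end IsOneBitModel
end Model

/-! ### Gaussian exponential moments and tail bounds -/

section Gaussian

theorem integrable_exp_sq_div_four_gaussianReal :
    Integrable (fun z : ℝ => Real.exp (z ^ 2 / 4)) (gaussianReal 0 1) := by
  rw [gaussianReal_of_var_ne_zero 0 one_ne_zero, integrable_withDensity_iff_integrable_smul'
    (by fun_prop) (by simp [gaussianPDF])]
  have h := (integrable_exp_neg_mul_sq (b := 1 / 4) (by norm_num)).const_mul (√(2 * Real.pi * 1))⁻¹
  refine h.congr (ae_of_all _ fun z => ?_)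
  simp only [toReal_gaussianPDF, gaussianPDFReal, smul_eq_mul, NNReal.coe_one, sub_zero]
  rw [mul_assoc (√(2 * Real.pi * 1))⁻¹, ← Real.exp_add]
  congr 2
  ring

theorem integral_exp_sq_div_four_gaussianReal :
    ∫ z : ℝ, Real.exp (z ^ 2 / 4) ∂(gaussianReal 0 1) = √2 := by
  rw [integral_gaussianReal_eq_integral_smul one_ne_zero]
  have h : ∀ z : ℝ, gaussianPDFReal 0 1 z • Real.exp (z ^ 2 / 4)
      = (√(2 * Real.pi))⁻¹ * Real.exp (-(1 / 4) * z ^ 2) := by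
    intro z
    simp only [gaussianPDFReal, smul_eq_mul, NNReal.coe_one, sub_zero, mul_one]
    rw [mul_assoc, ← Real.exp_add]
    congr 2
    ring
  simp_rw [h]
  rw [integral_const_mul, integral_gaussian, ← Real.sqrt_inv, ← Real.sqrt_mul (by positivity)]
  congr 1
  field_simp
  norm_num

/-- The soft-thresholded exponential moment of a standard Gaussian variable. -/
theorem lintegral_exp_sq_posPart_gaussianReal_le {T : ℝ} (hT : 0 ≤ T) :
    ∫⁻ z, ENNReal.ofReal (Real.exp ((max (|z| - T) 0) ^ 2 / 4)) ∂(gaussianReal 0 1)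
      ≤ ENNReal.ofReal (Real.exp (2 * Real.exp (-(T ^ 2 / 4)))) := by
  have hpt : ∀ z : ℝ, Real.exp ((max (|z| - T) 0) ^ 2 / 4)
      ≤ 1 + Real.exp (-(T ^ 2 / 4)) * Real.exp (z ^ 2 / 4) := by
    intro z
    rcases le_total |z| T with h | h
    · rw [max_eq_right (by linarith)]
      have := mul_pos (Real.exp_pos (-(T ^ 2 / 4))) (Real.exp_pos (z ^ 2 / 4))
      simpa using this.le
    · rw [max_eq_left (by linarith), ← Real.exp_add]
      -- For `|z| ≥ T ≥ 0`, `(|z| - T)² ≤ z² - T²`.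
      have h1 : (|z| - T) ^ 2 / 4 ≤ -(T ^ 2 / 4) + z ^ 2 / 4 := by
        have := sq_abs z
        nlinarith
      linarith [Real.exp_le_exp.2 h1]
  have hint := integrable_exp_sq_div_four_gaussianReal.const_mul (Real.exp (-(T ^ 2 / 4)))
  have hadd : Integrable (fun z : ℝ => 1 + Real.exp (-(T ^ 2 / 4)) * Real.exp (z ^ 2 / 4))
      (gaussianReal 0 1) := (integrable_const _).add hint
  refine (lintegral_mono fun z => ENNReal.ofReal_le_ofReal (hpt z)).trans ?_
  rw [← ofReal_integral_eq_lintegral_ofReal hadd (ae_of_all _ fun z => by positivity)]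
  refine ENNReal.ofReal_le_ofReal ?_
  rw [integral_add (integrable_const _) hint, integral_const_mul,
    integral_exp_sq_div_four_gaussianReal]
  have h2 : √2 ≤ 2 := by
    rw [Real.sqrt_le_left (by norm_num)]; norm_num
  have h3 := Real.add_one_le_exp (2 * Real.exp (-(T ^ 2 / 4)))
  have h4 := Real.exp_pos (-(T ^ 2 / 4))
  simp only [integral_const, probReal_univ, one_smul]
  nlinarith

theorem lintegral_exp_sum_sq_posPart_stdGaussian_le {n : ℕ} {T : ℝ} (hT : 0 ≤ T) :
    ∫⁻ v, ENNReal.ofReal (Real.exp ((∑ j, (max (|v j| - T) 0) ^ 2) / 4))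
        ∂(stdGaussian (EuclideanSpace ℝ (Fin n)))
      ≤ ENNReal.ofReal (Real.exp (n * (2 * Real.exp (-(T ^ 2 / 4))))) := by
  rw [← map_pi_eq_stdGaussian, lintegral_map (by fun_prop) (by fun_prop)]
  have h : ∀ v : Fin n → ℝ, ENNReal.ofReal (Real.exp
      ((∑ j, (max (|(WithLp.toLp 2 v : EuclideanSpace ℝ (Fin n)) j| - T) 0) ^ 2) / 4))
      = ∏ j, ENNReal.ofReal (Real.exp ((max (|v j| - T) 0) ^ 2 / 4)) := by
    intro v
    rw [Finset.sum_div, Real.exp_sum, ENNReal.ofReal_prod_of_nonneg fun _ _ => (Real.exp_pos _).le]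
  simp_rw [h]
  have hfm : Measurable fun z : ℝ => ENNReal.ofReal (Real.exp ((max (|z| - T) 0) ^ 2 / 4)) := by
    fun_prop
  rw [lintegral_prod_eq_prod_lintegral_of_indepFun Finset.univ
    (fun j (v : Fin n → ℝ) => ENNReal.ofReal (Real.exp ((max (|v j| - T) 0) ^ 2 / 4)))
    (iIndepFun_pi (X := fun _ z => ENNReal.ofReal (Real.exp ((max (|z| - T) 0) ^ 2 / 4)))
      fun _ => hfm.aemeasurable) (fun _ => by fun_prop)]
  simp_rw [fun j => (measurePreserving_eval (fun _ : Fin n => gaussianReal 0 1) j).lintegral_comp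
    hfm]
  simp only [Finset.prod_const, Finset.card_univ, Fintype.card_fin]
  rw [Real.exp_nat_mul, ENNReal.ofReal_pow (Real.exp_pos _).le]
  exact pow_le_pow_left' (lintegral_exp_sq_posPart_gaussianReal_le hT) n

theorem measure_sum_sq_posPart_gt_le {Ω : Type*} [MeasurableSpace Ω] {μ : Measure Ω}
    [IsProbabilityMeasure μ] {n : ℕ} {W : Ω → EuclideanSpace ℝ (Fin n)}
    (hW : HasLaw W (stdGaussian (EuclideanSpace ℝ (Fin n))) μ) {T r : ℝ} (hT : 0 ≤ T) :
    μ.real {ω | r < ∑ j, (max (|W ω j| - T) 0) ^ 2}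
      ≤ Real.exp (n * (2 * Real.exp (-(T ^ 2 / 4))) - r / 4) := by
  set F : EuclideanSpace ℝ (Fin n) → ENNReal := fun v =>
    ENNReal.ofReal (Real.exp ((∑ j, (max (|v j| - T) 0) ^ 2) / 4))
  have hFm : Measurable F := by fun_prop
  have h1 : {ω | r < ∑ j, (max (|W ω j| - T) 0) ^ 2}
      ⊆ {ω | ENNReal.ofReal (Real.exp (r / 4)) ≤ F (W ω)} := by
    intro ω hω
    refine ENNReal.ofReal_le_ofReal (Real.exp_le_exp.2 ?_)
    simp only [Set.mem_ofPred_eq] at hω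
    linarith
  have h2 := mul_meas_ge_le_lintegral₀ (μ := μ) (f := fun ω => F (W ω))
    (hFm.comp_aemeasurable hW.aemeasurable) (ENNReal.ofReal (Real.exp (r / 4)))
  rw [hW.lintegral_comp hFm.aemeasurable] at h2
  have h3 := (h2.trans (lintegral_exp_sum_sq_posPart_stdGaussian_le hT))
  have h4 := ENNReal.toReal_mono ENNReal.ofReal_ne_top h3
  rw [ENNReal.toReal_mul, ENNReal.toReal_ofReal (Real.exp_pos _).le,
    ENNReal.toReal_ofReal (Real.exp_pos _).le] at h4
  rw [Real.exp_sub, le_div_iff₀ (Real.exp_pos _), mul_comm]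
  refine le_trans ?_ h4
  gcongr
  exact measureReal_mono h1

/-- Keeps the linear term exact, so that after integration the mean enters the moment generating
function and only the square must be dominated by a Gaussian. -/
theorem Real.exp_le_add_exp_sq (u : ℝ) : Real.exp u ≤ u + Real.exp (u ^ 2) := by
  have h0 := Real.add_one_le_exp (u ^ 2)
  rcases le_total |u| 1 with h | h
  · have h1 := (abs_le.1 (Real.abs_exp_sub_one_sub_id_le h)).2
    linarith
  · rcases le_total 0 u with hu | hu
    · rw [abs_of_nonneg hu] at h
      have : Real.exp u ≤ Real.exp (u ^ 2) := Real.exp_le_exp.2 (by nlinarith)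
      linarith
    · rw [abs_of_nonpos hu] at h
      have : Real.exp u ≤ 1 := Real.exp_le_one_iff.2 hu
      nlinarith

theorem Real.exp_mul_le_one_add_mul_exp_sub {p v : ℝ} (h0 : 0 ≤ p) (h1 : p ≤ 1) :
    Real.exp (p * v) ≤ (1 - p) + p * Real.exp v := by
  have h := convexOn_exp.2 (Set.mem_univ 0) (Set.mem_univ v) (sub_nonneg.2 h1) h0 (by ring)
  simpa using h

/-- Chernoff's bound for the lower tail of sums of variables dominated by standard Gaussians. -/
theorem measure_sum_lt_le_of_abs_le_gaussian {Ω : Type*} [MeasurableSpace Ω] {μ : Measure Ω}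
    [IsProbabilityMeasure μ] {ι : Type*} [Fintype ι] {X g : ι → Ω → ℝ} {l ε : ℝ}
    (hind : iIndepFun X μ) (hX : ∀ i, Measurable (X i))
    (hg : ∀ i, HasLaw (g i) (gaussianReal 0 1) μ) (hXg : ∀ i, ∀ᵐ ω ∂μ, |X i ω| ≤ |g i ω|)
    (hint : ∀ i, Integrable (X i) μ) (hmean : ∀ i, ∫ ω, X i ω ∂μ = l)
    (hε0 : 0 ≤ ε) (hε : ε ≤ 2) :
    μ.real {ω | ∑ i, X i ω ≤ Fintype.card ι * (l - ε)}
      ≤ Real.exp (-(Fintype.card ι * ε ^ 2 / 8)) := by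
  -- This minimizes `-t ε + 2 t²`, with value `-ε²/8`. The assumption `ε ≤ 2` makes `4 t² ≤ 1`, a
  -- legitimate convexity weight in `exp (4 t² · g²/4)`.
  set t : ℝ := ε / 4 with ht
  have hp0 : 0 ≤ 4 * t ^ 2 := by positivity
  have hp1 : 4 * t ^ 2 ≤ 1 := by nlinarith
  have hexp : ∀ i, Integrable (fun ω => Real.exp (g i ω ^ 2 / 4)) μ := fun i => by
    have := integrable_exp_sq_div_four_gaussianReal
    rw [← (hg i).map_eq] at this
    exact this.comp_aemeasurable (hg i).aemeasurable
  have hexpv : ∀ i, ∫ ω, Real.exp (g i ω ^ 2 / 4) ∂μ = √2 := fun i => by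
    rw [← integral_exp_sq_div_four_gaussianReal]
    exact (hg i).integral_comp (f := fun z => Real.exp (z ^ 2 / 4)) (by fun_prop)
  have hpt : ∀ i, ∀ᵐ ω ∂μ, Real.exp (-t * X i ω)
      ≤ -t * X i ω + ((1 - 4 * t ^ 2) + 4 * t ^ 2 * Real.exp (g i ω ^ 2 / 4)) := by
    intro i
    filter_upwards [hXg i] with ω hω
    refine (Real.exp_le_add_exp_sq _).trans (add_le_add le_rfl ?_)
    refine le_trans (Real.exp_le_exp.2 ?_) (Real.exp_mul_le_one_add_mul_exp_sub hp0 hp1)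
    have := sq_le_sq.2 hω
    nlinarith [mul_le_mul_of_nonneg_left this (sq_nonneg t)]
  have hdom₁ : ∀ i, Integrable (fun ω =>
      (1 - 4 * t ^ 2) + 4 * t ^ 2 * Real.exp (g i ω ^ 2 / 4)) μ := fun i =>
    (integrable_const _).add ((hexp i).const_mul _)
  have hdom : ∀ i, Integrable (fun ω =>
      -t * X i ω + ((1 - 4 * t ^ 2) + 4 * t ^ 2 * Real.exp (g i ω ^ 2 / 4))) μ := fun i =>
    ((hint i).const_mul _).add (hdom₁ i)
  have hXe : ∀ i, Integrable (fun ω => Real.exp (-t * X i ω)) μ := fun i => by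
    refine (hdom i).mono' (by have := hX i; fun_prop) ?_
    filter_upwards [hpt i] with ω hω
    rwa [Real.norm_eq_abs, abs_of_pos (Real.exp_pos _)]
  have hmgf : ∀ i, mgf (X i) μ (-t) ≤ Real.exp (-t * l + 2 * t ^ 2) := fun i => by
    refine (integral_mono_ae (hXe i) (hdom i) (hpt i)).trans ?_
    rw [integral_add ((hint i).const_mul _) (hdom₁ i),
      integral_add (integrable_const _) ((hexp i).const_mul _), integral_const_mul,
      integral_const_mul, hmean, hexpv]
    simp only [integral_const, probReal_univ, one_smul]
    refine le_trans ?_ (Real.add_one_le_exp _)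
    have : √2 ≤ 3 / 2 := by
      rw [Real.sqrt_le_left (by norm_num)]; norm_num
    nlinarith [sq_nonneg t]
  have h := measure_le_le_exp_mul_mgf (X := ∑ i, X i) (t := -t) (μ := μ)
    (Fintype.card ι * (l - ε)) (by linarith) (hind.integrable_exp_mul_sum hX fun i _ => hXe i)
  simp only [Finset.sum_apply] at h
  refine h.trans ?_
  rw [hind.mgf_sum hX]
  calc _ ≤ Real.exp (-(-t) * (Fintype.card ι * (l - ε)))
          * ∏ _i : ι, Real.exp (-t * l + 2 * t ^ 2) := by
        gcongr with i
        · exact fun i _ => mgf_nonneg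
        · exact hmgf i
    _ = _ := by
        rw [Finset.prod_const, ← Real.exp_nat_mul, ← Real.exp_add, Finset.card_univ]
        congr 1
        rw [ht]
        ring

theorem hasLaw_inner_stdGaussian {E : Type*} [NormedAddCommGroup E] [InnerProductSpace ℝ E]
    [FiniteDimensional ℝ E] [MeasurableSpace E] [BorelSpace E] {x : E} (hx : ‖x‖ = 1) :
    HasLaw (fun v : E => ⟪v, x⟫) (gaussianReal 0 1) (stdGaussian E) := by
  refine ⟨by fun_prop, ?_⟩
  have h := IsGaussian.map_eq_gaussianReal (μ := stdGaussian E) (innerSL ℝ x)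
  rw [integral_strongDual_stdGaussian, variance_dual_stdGaussian, innerSL_apply_norm, hx] at h
  have h2 : (fun v : E => ⟪v, x⟫) = innerSL ℝ x := by
    ext v
    simp [real_inner_comm]
  rw [h2, h]
  simp

theorem hasLaw_inv_sqrt_smul_sum_stdGaussian {E Ω : Type*} [NormedAddCommGroup E]
    [InnerProductSpace ℝ E] [FiniteDimensional ℝ E] [MeasurableSpace E] [BorelSpace E]
    [MeasurableSpace Ω] {μ : Measure Ω} [IsProbabilityMeasure μ] {ι : Type*} [Fintype ι]
    [Nonempty ι] {b : ι → Ω → E} (hind : iIndepFun b μ)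
    (hlaw : ∀ i, HasLaw (b i) (stdGaussian E) μ) :
    HasLaw (fun ω => (√(Fintype.card ι))⁻¹ • ∑ i, b i ω) (stdGaussian E) μ := by
  have hm : ∀ i, AEMeasurable (b i) μ := fun i => (hlaw i).aemeasurable
  have hs : AEMeasurable (fun ω => ∑ i, b i ω) μ := Finset.aemeasurable_fun_sum _ fun i _ => hm i
  refine ⟨hs.const_smul _, Measure.ext_of_charFun ?_⟩
  have : IsProbabilityMeasure (μ.map fun ω => ∑ i, b i ω) := Measure.isProbabilityMeasure_map hs
  ext t
  rw [charFun_map_smul_comp hs, hind.charFun_map_fun_sum_eq_prod hm, Finset.prod_apply]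
  simp_rw [(hlaw _).map_eq, charFun_stdGaussian]
  rw [Finset.prod_const, ← Complex.exp_nat_mul, Finset.card_univ, norm_smul]
  congr 1
  have hc : (0 : ℝ) < Fintype.card ι := by exact_mod_cast Fintype.card_pos
  have : (‖(√(Fintype.card ι))⁻¹‖ * ‖t‖) ^ 2 = (Fintype.card ι : ℝ)⁻¹ * ‖t‖ ^ 2 := by
    rw [mul_pow, Real.norm_eq_abs, sq_abs, inv_pow, Real.sq_sqrt hc.le]
  norm_cast
  rw [this]
  field_simp

end Gaussian

/-! ### Deterministic analysis of the convex program -/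

section Deterministic

variable {n m : ℕ} {s : ℝ}

theorem isCompact_compressibleSet (n : ℕ) (s : ℝ) : IsCompact (compressibleSet n s) := by
  refine Metric.isCompact_of_isClosed_isBounded ?_ ?_
  · exact (isClosed_le continuous_norm continuous_const).inter
      (isClosed_le (f := fun x : EuclideanSpace ℝ (Fin n) => ∑ j, |x j|) (by fun_prop)
        continuous_const)
  · exact (Metric.isBounded_closedBall (x := 0) (r := 1)).subset
      fun x hx => mem_closedBall_zero_iff.2 hx.1

theorem exists_isProgramSolution {x : EuclideanSpace ℝ (Fin n)} (hx : x ∈ compressibleSet n s)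
    (v : Fin m → EuclideanSpace ℝ (Fin n)) (b : Fin m → ℝ) :
    ∃ xhat, IsProgramSolution s v b xhat := by
  obtain ⟨z, hz, hmax⟩ := (isCompact_compressibleSet n s).exists_isMaxOn ⟨x, hx⟩
    (f := fun x' => ∑ i, b i * ⟪v i, x'⟫) (by fun_prop)
  exact ⟨z, hz, hmax⟩

/-- Split `|W j| ≤ (|W j| - T)₊ + T`; Cauchy–Schwarz with `‖z‖₂ ≤ 1` handles the excess and `‖z‖₁ ≤
√s` the constant. -/
theorem abs_inner_le_of_mem_compressibleSet {z : EuclideanSpace ℝ (Fin n)}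
    (hz : z ∈ compressibleSet n s) (W : EuclideanSpace ℝ (Fin n)) {T : ℝ} (hT : 0 ≤ T) :
    |⟪W, z⟫| ≤ √(∑ j, (max (|W j| - T) 0) ^ 2) + T * √s := by
  have h1 : |⟪W, z⟫| ≤ ∑ j, (max (|W j| - T) 0 + T) * |z j| := by
    rw [PiLp.inner_apply]
    refine (Finset.abs_sum_le_sum_abs _ _).trans (Finset.sum_le_sum fun j _ => ?_)
    have : |W j| ≤ max (|W j| - T) 0 + T := by linarith [le_max_left (|W j| - T) 0]
    calc |⟪W j, z j⟫| = |W j| * |z j| := by simp [abs_mul, mul_comm]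
      _ ≤ _ := by gcongr
  have h2 : ∑ j, max (|W j| - T) 0 * |z j| ≤ √(∑ j, (max (|W j| - T) 0) ^ 2) := by
    refine (Real.sum_mul_le_sqrt_mul_sqrt _ _ _).trans ?_
    have : √(∑ j, |z j| ^ 2) ≤ 1 := by
      have := hz.1
      rw [EuclideanSpace.norm_eq] at this
      simpa using this
    exact mul_le_of_le_one_right (Real.sqrt_nonneg _) this
  simp_rw [add_mul, Finset.sum_add_distrib, ← Finset.mul_sum] at h1
  linarith [mul_le_mul_of_nonneg_left hz.2 hT]

/-- The measurement vector `v` with its component orthogonal to `x` multiplied by `b`. -/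
noncomputable def flipOrthogonal (x v : EuclideanSpace ℝ (Fin n)) (b : ℝ) : EuclideanSpace ℝ (Fin n) :=
  ⟪v, x⟫ • x + b • (v - ⟪v, x⟫ • x)

theorem inner_flipOrthogonal_self {x : EuclideanSpace ℝ (Fin n)} (hx : ‖x‖ = 1)
    (v : EuclideanSpace ℝ (Fin n)) (b : ℝ) :
    ⟪flipOrthogonal x v b, x⟫ = ⟪v, x⟫ := by
  simp [flipOrthogonal, inner_add_left, inner_sub_left, inner_smul_left, hx]

theorem mul_norm_sub_sq_le_of_isProgramSolution {x xhat : EuclideanSpace ℝ (Fin n)}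
    (hx : x ∈ compressibleSet n s) (hx1 : ‖x‖ = 1) {v : Fin m → EuclideanSpace ℝ (Fin n)}
    {b : Fin m → ℝ} (hsol : IsProgramSolution s v b xhat) {δ l : ℝ} (hm : 0 < m) (hl : 0 ≤ l)
    (hW : ∀ z ∈ compressibleSet n s, |⟪∑ i, flipOrthogonal x (v i) (b i), z⟫| ≤ m * (δ / 16))
    (hS : m * (l - δ / 8) ≤ ∑ i, b i * ⟪v i, x⟫) :
    l * ‖xhat - x‖ ^ 2 ≤ δ := by
  set w := ∑ i, flipOrthogonal x (v i) (b i) with hw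
  set S := ∑ i, b i * ⟪v i, x⟫ with hSdef
  have hm' : (0 : ℝ) < m := by exact_mod_cast hm
  have hwx : ⟪w, x⟫ = ∑ i, ⟪v i, x⟫ := by
    rw [hw, sum_inner]
    exact Finset.sum_congr rfl fun i _ => inner_flipOrthogonal_self hx1 _ _
  have hobj : ∀ z, ∑ i, b i * ⟪v i, z⟫ = ⟪w, z⟫ + (S - ⟪w, x⟫) * ⟪x, z⟫ := by
    intro z
    rw [hwx, hw, hSdef, sum_inner, sub_mul, Finset.sum_mul, Finset.sum_mul,
      ← Finset.sum_sub_distrib, ← Finset.sum_add_distrib]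
    refine Finset.sum_congr rfl fun i _ => ?_
    simp only [flipOrthogonal, inner_add_left, inner_sub_left, inner_smul_left, conj_trivial]
    ring
  have hxx : ⟪x, x⟫ = (1 : ℝ) := by simp [hx1]
  have hopt : ∑ i, b i * ⟪v i, x⟫ ≤ ∑ i, b i * ⟪v i, xhat⟫ := hsol.2 hx
  rw [hobj, hobj, hxx] at hopt
  have h1 := abs_le.1 (hW x hx)
  have h2 := abs_le.1 (hW xhat hsol.1)
  have hn := hsol.1.1
  have hq : |⟪x, xhat⟫| ≤ 1 := by
    refine (abs_real_inner_le_norm _ _).trans ?_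
    rwa [hx1, one_mul]
  have hq' := abs_le.1 hq
  have hnorm : ‖xhat - x‖ ^ 2 ≤ 2 * (1 - ⟪x, xhat⟫) := by
    rw [norm_sub_sq_real, hx1, real_inner_comm]
    nlinarith [norm_nonneg xhat]
  have hδ : 0 ≤ m * (δ / 16) := (abs_nonneg _).trans (hW x hx)
  have hwq : |⟪w, x⟫ * ⟪x, xhat⟫| ≤ m * (δ / 16) := by
    rw [abs_mul]
    calc _ ≤ m * (δ / 16) * 1 := mul_le_mul (hW x hx) hq (abs_nonneg _) hδ
      _ = _ := mul_one _
  have hwq' := abs_le.1 hwq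
  have hSD := mul_le_mul_of_nonneg_right hS (sub_nonneg.2 hq'.2)
  -- The two inner products with `w` cost `mδ/8` together; the deficit `mδ/8` in `S` is multiplied
  -- by `1 - ⟪x, xhat⟫ ≤ 2`. The total is `3mδ/8`.
  have hmain : (m : ℝ) * (l * (1 - ⟪x, xhat⟫)) ≤ m * (δ / 2) := by nlinarith
  have := le_of_mul_le_mul_left hmain hm'
  nlinarith [mul_le_mul_of_nonneg_left hnorm hl]

end Deterministic

/-! ### Law of the flipped measurement vectors -/

section Law

variable {Ω : Type*} [MeasurableSpace Ω] {μ : Measure Ω} [IsProbabilityMeasure μ] {n m : ℕ}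
  {θ : ℝ → ℝ} {x : EuclideanSpace ℝ (Fin n)} {a : Fin m → Ω → EuclideanSpace ℝ (Fin n)}
  {y : Fin m → Ω → ℝ}

theorem Measurable.flipOrthogonal {x : EuclideanSpace ℝ (Fin n)}
    {v : Ω → EuclideanSpace ℝ (Fin n)} {b : Ω → ℝ} (hv : Measurable v) (hb : Measurable b) :
    Measurable fun ω => flipOrthogonal x (v ω) (b ω) := by
  unfold _root_.flipOrthogonal
  fun_prop

theorem flipOrthogonal_one (x v : EuclideanSpace ℝ (Fin n)) : flipOrthogonal x v 1 = v := by
  simp [flipOrthogonal]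

theorem flipOrthogonal_neg_one (hx : ‖x‖ = 1) (v : EuclideanSpace ℝ (Fin n)) :
    flipOrthogonal x v (-1) = (ℝ ∙ x).reflection v := by
  rw [Submodule.reflection_singleton_apply, hx, real_inner_comm]
  simp only [flipOrthogonal, RCLike.ofReal_one, one_pow, div_one]
  module

namespace IsOneBitModel

omit [IsProbabilityMeasure μ] in
theorem hasLaw_inner (h : IsOneBitModel μ θ x a y) (hx : ‖x‖ = 1) (i : Fin m) :
    HasLaw (fun ω => ⟪a i ω, x⟫) (gaussianReal 0 1) μ :=
  (hasLaw_inner_stdGaussian hx).fun_comp (h.law_a i)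

theorem integral_y_mul_inner (h : IsOneBitModel μ θ x a y) (hθ : Measurable θ) (hx : ‖x‖ = 1)
    (i : Fin m) :
    Integrable (fun ω => y i ω * ⟪a i ω, x⟫) μ ∧
      ∫ ω, y i ω * ⟪a i ω, x⟫ ∂μ = linkCorrelation θ := by
  have hint : Integrable (fun ω => ⟪a i ω, x⟫) μ := by
    have h1 : Integrable (fun z : ℝ => z) (gaussianReal 0 1) := IsGaussian.integrable_id
    rw [← (h.hasLaw_inner hx i).map_eq] at h1
    exact h1.comp_aemeasurable (h.hasLaw_inner hx i).aemeasurable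
  refine ⟨h.integrable_y_mul i hint, ?_⟩
  rw [h.integral_y_mul i (ψ := fun v => ⟪v, x⟫) (by fun_prop) hint]
  exact (h.hasLaw_inner hx i).integral_comp (f := fun z => θ z * z) (by fun_prop)

/-- Integrate `y g ≤ (1 + g²)/2` with `g = ⟪a i, x⟫`. In the nontrivial case `δ < 4λ` this yields `δ
≤ 4`, as the Chernoff bound needs a bounded deviation. -/
theorem linkCorrelation_le_one (h : IsOneBitModel μ θ x a y) (hθ : Measurable θ) (hx : ‖x‖ = 1)
    (i : Fin m) : linkCorrelation θ ≤ 1 := by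
  have hg := h.hasLaw_inner hx i
  have h2 : Integrable (fun z : ℝ => z ^ 2) (gaussianReal 0 1) :=
    (IsGaussian.memLp_two_id (μ := gaussianReal 0 1)).integrable_sq
  have hv : ∫ z : ℝ, z ^ 2 ∂(gaussianReal 0 1) = 1 := by
    have := variance_of_integral_eq_zero (μ := gaussianReal 0 1) (X := fun z => z)
      (by fun_prop) (by simp)
    rw [variance_fun_id_gaussianReal] at this
    simpa using this.symm
  have h2' : Integrable (fun ω => ⟪a i ω, x⟫ ^ 2) μ := by
    rw [← hg.map_eq] at h2
    exact h2.comp_aemeasurable hg.aemeasurable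
  have hv' : ∫ ω, ⟪a i ω, x⟫ ^ 2 ∂μ = 1 := by
    rw [← hv]
    exact hg.integral_comp (f := fun z => z ^ 2) (by fun_prop)
  obtain ⟨hI, hE⟩ := h.integral_y_mul_inner hθ hx i
  have hle : ∫ ω, y i ω * ⟪a i ω, x⟫ ∂μ ≤ ∫ ω, (1 / 2 + 1 / 2 * ⟪a i ω, x⟫ ^ 2) ∂μ := by
    refine integral_mono_ae hI ((integrable_const _).add (h2'.const_mul _)) ?_
    filter_upwards [h.sign_y i] with ω hω
    rcases hω with hω | hω <;> rw [hω] <;>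
      nlinarith [sq_nonneg (⟪a i ω, x⟫ - 1), sq_nonneg (⟪a i ω, x⟫ + 1)]
  rw [hE, integral_add (integrable_const _) (h2'.const_mul _), integral_const_mul, hv'] at hle
  simp only [integral_const, probReal_univ, one_smul] at hle
  linarith

/-- Reflecting `a i` along the axis `x` according to the sign `y i` leaves its law unchanged, since
the conditional mean of `y i` is invariant under this reflection. -/
theorem hasLaw_flipOrthogonal (h : IsOneBitModel μ θ x a y) (hθ : Measurable θ) (hx : ‖x‖ = 1)
    (i : Fin m) :
    HasLaw (fun ω => flipOrthogonal x (a i ω) (y i ω))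
      (stdGaussian (EuclideanSpace ℝ (Fin n))) μ := by
  have hm : Measurable fun ω => flipOrthogonal x (a i ω) (y i ω) :=
    (h.measurable_a i).flipOrthogonal (h.measurable_y i)
  refine ⟨hm.aemeasurable, Measure.ext fun A hA => ?_⟩
  set γ := stdGaussian (EuclideanSpace ℝ (Fin n))
  let R := (ℝ ∙ x).reflection
  have hR : HasLaw R γ γ := ⟨R.continuous.aemeasurable, stdGaussian_map R⟩
  have hRa : HasLaw (fun ω => R (a i ω)) γ μ := hR.fun_comp (h.law_a i)
  have hRx : ∀ v, ⟪R v, x⟫ = ⟪v, x⟫ := fun v => by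
    rw [← flipOrthogonal_neg_one hx, inner_flipOrthogonal_self hx]
  set f : EuclideanSpace ℝ (Fin n) → ℝ := A.indicator fun _ => 1
  have hfm : Measurable f := measurable_const.indicator hA
  have hRm : Measurable R := R.continuous.measurable
  have hfint : ∀ u : Ω → EuclideanSpace ℝ (Fin n), Measurable u →
      Integrable (fun ω => f (u ω)) μ := fun u hu =>
    (integrable_const (1 : ℝ)).indicator (hu hA)
  have hI : ∀ u : Ω → EuclideanSpace ℝ (Fin n), Measurable u →
      ∫ ω, f (u ω) ∂μ = μ.real (u ⁻¹' A) := fun u hu => by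
    rw [← integral_indicator_one (hu hA)]
    rfl
  have ha := hfint _ (h.measurable_a i)
  have hRa' := hfint _ (hRm.comp (h.measurable_a i))
  simp only [Function.comp_apply] at hRa'
  have hI₁ : ∫ ω, f (R (a i ω)) ∂μ = ∫ ω, f (a i ω) ∂μ :=
    (hRa.integral_comp (f := f) hfm.aestronglyMeasurable).trans
      ((h.law_a i).integral_comp (f := f) hfm.aestronglyMeasurable).symm
  have hJ : ∫ ω, y i ω * f (R (a i ω)) ∂μ = ∫ ω, y i ω * f (a i ω) ∂μ := by
    rw [h.integral_y_mul i hfm ha, h.integral_y_mul i (ψ := fun v => f (R v)) (hfm.comp hRm) hRa']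
    have hG : Measurable fun v => θ ⟪v, x⟫ * f v := by fun_prop
    calc ∫ ω, θ ⟪a i ω, x⟫ * f (R (a i ω)) ∂μ
        = ∫ ω, θ ⟪R (a i ω), x⟫ * f (R (a i ω)) ∂μ := by simp_rw [hRx]
      _ = _ := (hRa.integral_comp (f := fun v => θ ⟪v, x⟫ * f v)
          hG.aestronglyMeasurable).trans ((h.law_a i).integral_comp
            (f := fun v => θ ⟪v, x⟫ * f v) hG.aestronglyMeasurable).symm
  -- The weights `(1 ± y)/2` are the indicators of `y = ±1`. By `hJ` and `hI₁` the terms containing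
  -- `y` cancel and the others add up to the integral of `f (a i)`.
  have hsplit : ∫ ω, f (flipOrthogonal x (a i ω) (y i ω)) ∂μ
      = ∫ ω, (1 / 2 * (f (a i ω) + y i ω * f (a i ω))
          + 1 / 2 * (f (R (a i ω)) - y i ω * f (R (a i ω)))) ∂μ := by
    refine integral_congr_ae ?_
    filter_upwards [h.sign_y i] with ω hω
    rcases hω with hω | hω
    · rw [hω, flipOrthogonal_neg_one hx]; ring
    · rw [hω, flipOrthogonal_one]; ring
  have hy₁ := h.integrable_y_mul i ha
  have hy₂ := h.integrable_y_mul i hRa'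
  have hadd : Integrable (fun ω => f (a i ω) + y i ω * f (a i ω)) μ := ha.add hy₁
  have hsub : Integrable (fun ω => f (R (a i ω)) - y i ω * f (R (a i ω))) μ := hRa'.sub hy₂
  rw [integral_add (hadd.const_mul _) (hsub.const_mul _), integral_const_mul,
    integral_const_mul, integral_add ha hy₁, integral_sub hRa' hy₂, hJ, hI₁, hI _ hm] at hsplit
  rw [Measure.map_apply hm hA, show γ = _ from (h.law_a i).map_eq.symm,
    Measure.map_apply (h.measurable_a i) hA,
    ← ENNReal.toReal_eq_toReal_iff' (measure_ne_top _ _) (measure_ne_top _ _)]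
  change μ.real _ = μ.real _
  rw [hsplit, ← hI _ (h.measurable_a i)]
  ring

end IsOneBitModel

end Law

/-! ### Concentration in the one-bit model -/

section Probability

variable {Ω : Type*} [MeasurableSpace Ω] {μ : Measure Ω} [IsProbabilityMeasure μ] {n m : ℕ}
  {θ : ℝ → ℝ} {x : EuclideanSpace ℝ (Fin n)} {a : Fin m → Ω → EuclideanSpace ℝ (Fin n)}
  {y : Fin m → Ω → ℝ}

namespace IsOneBitModel

theorem measure_sum_mul_inner_le (h : IsOneBitModel μ θ x a y) (hθ : Measurable θ) (hx : ‖x‖ = 1)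
    {ε : ℝ} (hε0 : 0 ≤ ε) (hε : ε ≤ 2) :
    μ.real {ω | ∑ i, y i ω * ⟪a i ω, x⟫ ≤ m * (linkCorrelation θ - ε)}
      ≤ Real.exp (-(m * ε ^ 2 / 8)) := by
  have hind : iIndepFun (fun i ω => y i ω * ⟪a i ω, x⟫) μ :=
    (h.iIndepFun_prodMk hθ).comp (fun _ p => p.2 * ⟪p.1, x⟫) (fun _ => by fun_prop)
  have hmeas : ∀ i, Measurable fun ω => y i ω * ⟪a i ω, x⟫ := fun i => by
    have := h.measurable_a i
    have := h.measurable_y i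
    fun_prop
  have key := measure_sum_lt_le_of_abs_le_gaussian (g := fun i ω => ⟪a i ω, x⟫) hind hmeas
    (fun i => h.hasLaw_inner hx i) (fun i => ?_)
    (fun i => (h.integral_y_mul_inner hθ hx i).1) (fun i => (h.integral_y_mul_inner hθ hx i).2)
    hε0 hε
  · simpa only [Fintype.card_fin] using key
  · filter_upwards [h.ae_abs_y_le i] with ω hω
    rw [abs_mul]
    exact mul_le_of_le_one_left (abs_nonneg _) hω

theorem hasLaw_normalized_sum_flipOrthogonal (h : IsOneBitModel μ θ x a y) (hθ : Measurable θ)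
    (hx : ‖x‖ = 1) (hm : 0 < m) :
    HasLaw (fun ω => (√m)⁻¹ • ∑ i, flipOrthogonal x (a i ω) (y i ω))
      (stdGaussian (EuclideanSpace ℝ (Fin n))) μ := by
  have : Nonempty (Fin m) := ⟨⟨0, hm⟩⟩
  have hind : iIndepFun (fun i ω => flipOrthogonal x (a i ω) (y i ω)) μ :=
    (h.iIndepFun_prodMk hθ).comp (fun _ p => flipOrthogonal x p.1 p.2)
      (fun _ => measurable_fst.flipOrthogonal measurable_snd)
  have key := hasLaw_inv_sqrt_smul_sum_stdGaussian hind fun i => h.hasLaw_flipOrthogonal hθ hx i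
  simpa only [Fintype.card_fin] using key

end IsOneBitModel

end Probability

/-! ### Choice of constants and conclusion -/

theorem norm_sub_sq_le_four_of_mem_compressibleSet {n : ℕ} {s : ℝ}
    {x z : EuclideanSpace ℝ (Fin n)} (hx : x ∈ compressibleSet n s)
    (hz : z ∈ compressibleSet n s) : ‖z - x‖ ^ 2 ≤ 4 := by
  have h := norm_sub_le z x
  have := hx.1
  have := hz.1
  nlinarith [norm_nonneg (z - x)]

theorem mainTheorem4 :
    ∃ C c : ℝ, 0 < C ∧ 0 < c ∧
      ∀ (Ω : Type*) [MeasurableSpace Ω] (μ : Measure Ω) [IsProbabilityMeasure μ]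
        (n m : ℕ) (s δ : ℝ) (θ : ℝ → ℝ) (x : EuclideanSpace ℝ (Fin n))
        (a : Fin m → Ω → EuclideanSpace ℝ (Fin n)) (y : Fin m → Ω → ℝ),
        0 < s → s ≤ n → 0 < δ → Measurable θ → 0 < linkCorrelation θ →
        x ∈ compressibleSet n s → ‖x‖ = 1 →
        IsOneBitModel μ θ x a y →
        C * δ⁻¹ ^ 2 * (s * Real.log (2 * n / s)) ≤ m →
        ∃ E : Set Ω, MeasurableSet E ∧ 1 - 8 * Real.exp (-(c * δ ^ 2 * m)) ≤ μ.real E ∧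
          ∀ ω ∈ E,
            (∃ xhat, IsProgramSolution s (fun i => a i ω) (fun i => y i ω) xhat) ∧
            ∀ xhat, IsProgramSolution s (fun i => a i ω) (fun i => y i ω) xhat →
              ‖xhat - x‖ ^ 2 ≤ δ / linkCorrelation θ := by
  refine ⟨16384, 1 / 8192, by norm_num, by norm_num, ?_⟩
  intro Ω _ μ _ n m s δ θ x a y hs hsn hδ hθ hl hxK hx hmod hm
  -- If `δ ≥ 4λ`, the claimed bound is at least `4`, the squared diameter bound for the feasible
  -- set.
  rcases le_or_gt (4 * linkCorrelation θ) δ with hlarge | hsmall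
  · refine ⟨Set.univ, .univ, ?_, fun ω _ =>
      ⟨exists_isProgramSolution hxK _ _, fun xhat hsol => ?_⟩⟩
    · have := Real.exp_pos (-(1 / 8192 * δ ^ 2 * m))
      rw [probReal_univ]
      linarith
    · rw [le_div_iff₀ hl]
      nlinarith [norm_sub_sq_le_four_of_mem_compressibleSet hxK hsol.1]
  set L := Real.log (2 * n / s) with hL
  have hn : (0 : ℝ) < n := hs.trans_le hsn
  have hL2 : 1 / 2 ≤ L := by
    have h1 : Real.log 2 ≤ L :=
      Real.log_le_log (by norm_num) (by rw [le_div_iff₀ hs]; linarith)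
    linarith [Real.log_two_gt_d9]
  have hsL : 16384 * (s * L) ≤ δ ^ 2 * m := by
    have := mul_le_mul_of_nonneg_left hm (sq_nonneg δ)
    calc 16384 * (s * L) = δ ^ 2 * (16384 * δ⁻¹ ^ 2 * (s * L)) := by field_simp
      _ ≤ _ := this
  have hmpos : (0 : ℝ) < m := by
    have : 0 < δ ^ 2 * (m : ℝ) := lt_of_lt_of_le (by positivity) hsL
    exact pos_of_mul_pos_right this (sq_nonneg δ)
  have hm0 : 0 < m := by exact_mod_cast hmpos
  have hδ4 : δ ≤ 4 := by linarith [hmod.linkCorrelation_le_one hθ hx ⟨0, hm0⟩]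
  -- Chosen so that `2n exp (-T²/4) = s`, which makes the thresholded exponential moment at most
  -- `exp s`.
  set T := 2 * √L with hT
  have hT0 : 0 ≤ T := by positivity
  have hT2 : T ^ 2 / 4 = L := by
    rw [hT, mul_pow, Real.sq_sqrt (by linarith)]
    ring
  set W : Ω → EuclideanSpace ℝ (Fin n) :=
    fun ω => (√m)⁻¹ • ∑ i, flipOrthogonal x (a i ω) (y i ω) with hWdef
  set r := δ ^ 2 * m / 1024 with hr
  set A := {ω | ∑ i, y i ω * ⟪a i ω, x⟫ ≤ m * (linkCorrelation θ - δ / 8)}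
  set B := {ω | r < ∑ j, (max (|W ω j| - T) 0) ^ 2}
  have ha := hmod.measurable_a
  have hy := hmod.measurable_y
  have hflip : ∀ i, Measurable fun ω => flipOrthogonal x (a i ω) (y i ω) :=
    fun i => (ha i).flipOrthogonal (hy i)
  have hWm : Measurable W := by fun_prop
  have hAm : MeasurableSet A := measurableSet_le (by fun_prop) measurable_const
  have hBm : MeasurableSet B := measurableSet_lt measurable_const (by fun_prop)
  have hPA : μ.real A ≤ Real.exp (-(1 / 8192 * δ ^ 2 * m)) := by
    refine (hmod.measure_sum_mul_inner_le hθ hx (by positivity) (by linarith)).trans ?_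
    refine Real.exp_le_exp.2 ?_
    nlinarith [mul_pos (pow_pos hδ 2) hmpos]
  have hPB : μ.real B ≤ Real.exp (-(1 / 8192 * δ ^ 2 * m)) := by
    refine (measure_sum_sq_posPart_gt_le
      (hmod.hasLaw_normalized_sum_flipOrthogonal hθ hx hm0) hT0).trans ?_
    refine Real.exp_le_exp.2 ?_
    have h1 : (n : ℝ) * (2 * Real.exp (-(T ^ 2 / 4))) = s := by
      rw [hT2, Real.exp_neg, hL, Real.exp_log (by positivity)]
      field_simp
    rw [h1, hr]
    -- Since `L ≥ 1/2`, `s ≤ 2sL ≤ δ²m/8192`, half of `r/4 = δ²m/4096`; the other half is the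
    -- exponent.
    nlinarith
  refine ⟨(A ∪ B)ᶜ, (hAm.union hBm).compl, ?_, fun ω hω =>
    ⟨exists_isProgramSolution hxK _ _, fun xhat hsol => ?_⟩⟩
  -- The two bad events cost only `2 exp (-c δ² m)`; the factor `8` is slack.
  · rw [probReal_compl_eq_one_sub (hAm.union hBm)]
    have := measureReal_union_le (μ := μ) A B
    have := Real.exp_pos (-(1 / 8192 * δ ^ 2 * m))
    linarith
  have hωA : m * (linkCorrelation θ - δ / 8) ≤ ∑ i, y i ω * ⟪a i ω, x⟫ := by
    by_contra! hcon
    exact hω (Or.inl hcon.le)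
  have hωB : ∑ j, (max (|W ω j| - T) 0) ^ 2 ≤ r := not_lt.1 fun hcon => hω (Or.inr hcon)
  rw [le_div_iff₀ hl, mul_comm]
  refine mul_norm_sub_sq_le_of_isProgramSolution hxK hx hsol hm0 hl.le (fun z hz => ?_) hωA
  have hsqrt : 0 < √(m : ℝ) := Real.sqrt_pos.2 hmpos
  have hsum : ∑ i, flipOrthogonal x (a i ω) (y i ω) = √(m : ℝ) • W ω := by
    rw [hWdef, smul_inv_smul₀ hsqrt.ne']
  have h1 := abs_inner_le_of_mem_compressibleSet hz (W ω) hT0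
  have h2 : √(∑ j, (max (|W ω j| - T) 0) ^ 2) ≤ √m * (δ / 32) := by
    refine Real.sqrt_le_iff.2 ⟨by positivity, hωB.trans ?_⟩
    rw [mul_pow, Real.sq_sqrt hmpos.le, hr]
    exact le_of_eq (by ring)
  have h3 : T * √s ≤ √m * (δ / 32) := by
    refine abs_le_of_sq_le_sq' ?_ (by positivity) |>.2
    have hT2' : T ^ 2 = 4 * L := by linarith
    rw [mul_pow T, mul_pow √(m : ℝ), hT2', Real.sq_sqrt hmpos.le, Real.sq_sqrt hs.le]
    nlinarith [mul_pos (pow_pos hδ 2) hmpos]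
  rw [hsum, real_inner_smul_left, abs_mul, abs_of_pos hsqrt]
  calc √(m : ℝ) * |⟪W ω, z⟫| ≤ √m * (√m * (δ / 16)) :=
        mul_le_mul_of_nonneg_left (by linarith) hsqrt.le
    _ = m * (δ / 16) := by rw [← mul_assoc, Real.mul_self_sqrt hmpos.le]
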